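/- There is a universal constant $C>0$ such that the following holds. Let $G=(V,E)$ be a finite connected (simple) graph with $|V|=n\ge 1$ vertices. Let the initial opinions $\{f_0(v)\}_{v\in V}$ be i.i.d. real random variables with $|f_0(v)|\le 1$ almost surely, and equip the edges with independent unit-rate Poisson clocks that are independent of the initial opinions. Let $(f_t)_{t\ge 0}$ be the edge-averaging process: the opinion $f_t(v)$ of a vertex stays constant as long as no edge incident to $v$ rings, and when the clock of an edge $uv\in E$ rings at time $t>0$, both endpoints update to $$f_t(u)=f_t(v)=\frac{f_{t-}(u)+f_{t-}(v)}{2},\qquad f_{t-}(w):=\lim_{s\uparrow t}f_s(w).$$ For $f\colon V\to\mathbb R$ let $\mathrm{osc}(f):=\sup_{u,v\in V}|f(u)-f(v)|$, and for $\varepsilon>0$ let $\tau_\varepsilon:=\inf\{t\ge 0:\mathrm{osc}(f_t)\le\varepsilon\}$ (with $\inf\emptyset=\infty$). Then for every $\varepsilon>0$, $$\mathbb E[\tau_\varepsilon]\le \frac{C\,(\log n)^2}{\varepsilon^4}.$$ -/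

import Mathlib

open MeasureTheory ProbabilityTheory Filter Topology
open scoped NNReal ENNReal

universe u v

/-- A unit-rate Poisson process `N` under `P`: `N t` counts the points in `(0, t]`. The paths start
at `0`, are nondecreasing and right-continuous almost surely, the increments over disjoint
intervals are independent, and the increment over `(s, t]` is Poisson with mean `t - s`. -/
structure IsUnitPoissonProcess {Ω : Type v} [MeasurableSpace Ω] (N : ℝ≥0 → Ω → ℕ)
    (P : Measure Ω) : Prop where
  measurable : ∀ t, Measurable (N t)
  paths : ∀ᵐ ω ∂P, N 0 ω = 0 ∧ Monotone (fun t => N t ω) ∧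
    ∀ t, ContinuousWithinAt (fun s => N s ω) (Set.Ici t) t
  indep_increments : HasIndepIncrements N P
  law_increments : ∀ s t : ℝ≥0, s ≤ t → HasLaw (fun ω => N t ω - N s ω) (poissonMeasure (t - s)) P

/-- The set of times at which a clock with counting path `k` rings, i.e. its jump times. -/
def ringTimes (k : ℝ≥0 → ℕ) : Set ℝ≥0 :=
  {t | 0 < t ∧ ∀ s < t, k s ≠ k t}

/-- `x` is a trajectory of the edge-averaging dynamics on `G` when edge `e` rings at the times in
`ring e`: the opinion of a vertex stays constant as long as no incident edge rings, and when the
edge `uv` rings at time `t`, both end vertices take the average of their two opinions just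
before `t` (left limits). -/
structure IsAveragingPath {V : Type u} (G : SimpleGraph V) (ring : G.edgeSet → Set ℝ≥0)
    (x : ℝ≥0 → V → ℝ) : Prop where
  const : ∀ (w : V) (s t : ℝ≥0), s ≤ t →
    (∀ e : G.edgeSet, w ∈ (e : Sym2 V) → ∀ r ∈ Set.Ioc s t, r ∉ ring e) → x t w = x s w
  update : ∀ (w z : V) (h : G.Adj w z) (t : ℝ≥0), t ∈ ring ⟨s(w, z), h⟩ →
    ∃ a b : ℝ, Tendsto (fun s => x s w) (𝓝[<] t) (𝓝 a) ∧
      Tendsto (fun s => x s z) (𝓝[<] t) (𝓝 b) ∧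
      x t w = (a + b) / 2 ∧ x t z = (a + b) / 2

/-- `f` is the edge-averaging process on `G` driven by the edge clocks `N`: the clocks are
independent unit-rate Poisson processes, they are jointly independent of the initial opinions,
and almost every trajectory of `f` follows the averaging dynamics. -/
structure IsEdgeAveragingProcess {V : Type u} {Ω : Type v} [MeasurableSpace Ω] (G : SimpleGraph V)
    (N : G.edgeSet → ℝ≥0 → Ω → ℕ) (f : ℝ≥0 → V → Ω → ℝ) (P : Measure Ω) : Prop where
  poisson : ∀ e, IsUnitPoissonProcess (N e) P
  indep_clocks : iIndepFun (fun e ω t => N e t ω) P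
  indep_initial : IndepFun (fun ω w => f 0 w ω) (fun ω e t => N e t ω) P
  dynamics : ∀ᵐ ω ∂P,
    IsAveragingPath G (fun e => ringTimes (fun t => N e t ω)) (fun t w => f t w ω)

/-- Oscillation of a function. -/
noncomputable def osc {V : Type u} (g : V → ℝ) : ℝ :=
  ⨆ p : V × V, |g p.1 - g p.2|

/-- The first time at which the oscillation of the trajectory `x` is at most `ε`
(`∞` if there is none). -/
noncomputable def consensusTime {V : Type u} (x : ℝ≥0 → V → ℝ) (ε : ℝ) : ℝ≥0∞ :=
  ⨅ (t : ℝ≥0) (_ : osc (x t) ≤ ε), (t : ℝ≥0∞)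

/-! Averaging over an edge is self-adjoint, so the opinion at `v` at time `t` is a weighted sum of
the initial opinions. The weights form the probability vector obtained from the unit mass at `v` by
running the averagings in reverse order (`sum_mul_eq_sum_fragment_mul`). Given the clocks,
Hoeffding's inequality bounds differences of opinions once these weights are close to uniform in
`ℓ²`, so the task is to bound their excess `S`.

Averaging over `e` lowers `S` by half the squared difference across `e`, and the Nash inequality
`excess_pow_three_le` says these squared differences add up to at least `S ^ 3 / 8`. Heuristically
`S' ≤ -S ^ 3 / 16`, so `S` is of order `t ^ (-1/2)` on every connected graph. The function `exp (-8
/ S ^ 2)`, whose mean decays like `exp (-t / 2)`, upgrades this to an exponentially small failure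
probability (`sum_seqWeight_excess_gt_le`). Hoeffding and a union bound over pairs then give failure
probability about `n ^ 2 * exp (-c * ε ^ 2 * √t)`, which is small once `t` is of order `(log n) ^ 2
/ ε ^ 4`; summing over multiples of that time bounds the expectation.

Continuous time is handled by cutting `[0, t]` into `K` equal intervals, discarding the event that
some interval contains two rings, and letting `K → ∞`. -/

/-- The value of `g` averaged over the two end vertices of `e`. -/
noncomputable def edgeMean {V : Type u} (g : V → ℝ) (e : Sym2 V) : ℝ :=
  Sym2.lift ⟨fun x y => (g x + g y) / 2, fun x y => by simp only [add_comm]⟩ e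

/-- The square of the difference of `g` across the edge `e`. -/
noncomputable def sqDiff {V : Type u} (g : V → ℝ) (e : Sym2 V) : ℝ :=
  Sym2.lift ⟨fun x y => (g x - g y) ^ 2, fun x y => by ring⟩ e

open Classical in
/-- Averaging over an edge, or doing nothing. -/
noncomputable def avgStep {V : Type u} {G : SimpleGraph V} (a : Option G.edgeSet) (g : V → ℝ) :
    V → ℝ :=
  match a with
  | none => g
  | some e => fun w => if w ∈ (e : Sym2 V) then edgeMean g e else g w

@[simp]
lemma edgeMean_mk {V : Type u} (g : V → ℝ) (x y : V) : edgeMean g s(x, y) = (g x + g y) / 2 := rfl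

@[simp]
lemma sqDiff_mk {V : Type u} (g : V → ℝ) (x y : V) : sqDiff g s(x, y) = (g x - g y) ^ 2 := rfl

lemma sqDiff_nonneg {V : Type u} (g : V → ℝ) (e : Sym2 V) : 0 ≤ sqDiff g e := by
  induction e with | _ x y => exact sq_nonneg _

@[simp]
lemma avgStep_none {V : Type u} {G : SimpleGraph V} (g : V → ℝ) :
    avgStep (none : Option G.edgeSet) g = g := rfl

/-! ### One averaging step, and the Nash inequality -/

section Averaging

variable {V : Type u} [Fintype V] {G : SimpleGraph V}

/-- The correction term is symmetric in `g` and `k`, which yields self-adjointness, and it vanishes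
when `k` is already averaged over the edge, which yields the exact energy loss. -/
lemma sum_avgStep_some_mul {x y : V} (h : G.Adj x y) (g k : V → ℝ) :
    ∑ w, avgStep (some ⟨s(x, y), h⟩ : Option G.edgeSet) g w * k w =
      ∑ w, g w * k w - (g x - g y) * (k x - k y) / 2 := by
  classical
  have hxy : x ≠ y := h.ne
  have key : ∀ w, avgStep (some ⟨s(x, y), h⟩ : Option G.edgeSet) g w * k w = g w * k w +
      ((if w = x then (g y - g x) / 2 * k x else 0) +
        (if w = y then (g x - g y) / 2 * k y else 0)) := by
    intro w
    simp only [avgStep, Sym2.mem_iff, edgeMean_mk]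
    by_cases h1 : w = x
    · subst h1; simp [hxy]; ring
    · by_cases h2 : w = y
      · subst h2; simp [h1]; ring
      · simp [h1, h2]
  simp_rw [key, Finset.sum_add_distrib]
  simp
  ring

lemma sum_avgStep_mul_comm (a : Option G.edgeSet) (g k : V → ℝ) :
    ∑ w, avgStep a g w * k w = ∑ w, g w * avgStep a k w := by
  rcases a with _ | ⟨e, he⟩
  · rfl
  · induction e with | _ x y =>
    calc _ = ∑ w, g w * k w - (g x - g y) * (k x - k y) / 2 := sum_avgStep_some_mul he g k
      _ = ∑ w, k w * g w - (k x - k y) * (g x - g y) / 2 := by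
        simp only [mul_comm (g _), mul_comm (g x - g y)]
      _ = _ := (sum_avgStep_some_mul he k g).symm
      _ = _ := Finset.sum_congr rfl fun w _ => mul_comm _ _

lemma sum_avgStep (a : Option G.edgeSet) (g : V → ℝ) : ∑ w, avgStep a g w = ∑ w, g w := by
  rcases a with _ | ⟨e, he⟩
  · rfl
  · induction e with | _ x y =>
    have := sum_avgStep_some_mul he g 1
    simpa using this

lemma sum_avgStep_some_sq (e : G.edgeSet) (g : V → ℝ) :
    ∑ w, avgStep (some e) g w ^ 2 = ∑ w, g w ^ 2 - sqDiff g e / 2 := by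
  obtain ⟨e, he⟩ := e
  induction e with | _ x y =>
  have h1 := sum_avgStep_some_mul he g (avgStep (some ⟨s(x, y), he⟩ : Option G.edgeSet) g)
  have h2 := sum_avgStep_mul_comm (some ⟨s(x, y), he⟩ : Option G.edgeSet) g g
  have h3 := sum_avgStep_some_mul he g g
  have h4 : avgStep (some ⟨s(x, y), he⟩ : Option G.edgeSet) g x =
      avgStep (some ⟨s(x, y), he⟩ : Option G.edgeSet) g y := by
    simp [avgStep]
  simp only [h4, sub_self, mul_zero, zero_div, sub_zero, ← h2] at h1
  simp only [sq, sqDiff_mk]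
  rw [h1, h3]

omit [Fintype V] in
lemma avgStep_nonneg (a : Option G.edgeSet) {g : V → ℝ} (hg : ∀ w, 0 ≤ g w) (w : V) :
    0 ≤ avgStep a g w := by
  rcases a with _ | ⟨e, he⟩
  · exact hg w
  · induction e with | _ x y =>
    simp only [avgStep, edgeMean_mk]
    split_ifs
    · linarith [hg x, hg y]
    · exact hg w

/-- Squared `ℓ²` distance of a probability vector from the uniform one. -/
noncomputable def excess (g : V → ℝ) : ℝ := ∑ w, g w ^ 2 - 1 / Fintype.card V

lemma excess_nonneg [Nonempty V] {g : V → ℝ} (h1 : ∑ w, g w = 1) : 0 ≤ excess g := by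
  have hn : (0 : ℝ) < Fintype.card V := by exact_mod_cast Fintype.card_pos
  have := sq_sum_le_card_mul_sum_sq (s := Finset.univ) (f := g)
  rw [h1] at this
  simp only [Finset.card_univ] at this
  rw [excess, sub_nonneg, div_le_iff₀ hn]
  nlinarith

lemma excess_avgStep_some (e : G.edgeSet) (g : V → ℝ) :
    excess (avgStep (some e) g) = excess g - sqDiff g e / 2 := by
  simp only [excess, sum_avgStep_some_sq]; ring

-- Cauchy–Schwarz for the increments of `g` along the walk.
omit [Fintype V] in
lemma sq_sub_le_length_mul_sum_sqDiff (g : V → ℝ) {x y : V} (p : G.Walk x y) :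
    (g x - g y) ^ 2 ≤ p.length * (p.edges.map (sqDiff g)).sum := by
  induction p with
  | nil => simp
  | @cons x z y h p ih =>
    simp only [SimpleGraph.Walk.length_cons, SimpleGraph.Walk.edges_cons, List.map_cons,
      List.sum_cons, sqDiff_mk, Nat.cast_add, Nat.cast_one]
    set T := (p.edges.map (sqDiff g)).sum
    set L : ℝ := (p.length : ℝ)
    have hL : 0 ≤ L := Nat.cast_nonneg _
    have hT : 0 ≤ T := List.sum_nonneg (by
      intro a ha
      obtain ⟨e, -, rfl⟩ := List.mem_map.1 ha
      exact sqDiff_nonneg g e)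
    rcases Nat.eq_zero_or_pos p.length with h0 | h0
    · have hL0 : L = 0 := by simp [L, h0]
      rw [hL0] at ih ⊢
      have : g z - g y = 0 := by nlinarith [sq_nonneg (g z - g y)]
      have : g y = g z := by linarith
      rw [this]; nlinarith
    · have hL1 : 0 < L := by simpa [L] using h0
      -- With `a`, `b` the two increments, `2 * L * a * b ≤ L ^ 2 * a ^ 2 + b ^ 2`, and `b ^ 2 ≤ L *
      -- T` by induction.
      have key : L * (g x - g y) ^ 2 ≤ L * ((L + 1) * ((g x - g z) ^ 2 + T)) := by
        nlinarith [sq_nonneg (L * (g x - g z) - (g z - g y))]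
      exact le_of_mul_le_mul_left key hL1

/-- A Nash inequality for probability vectors on a connected graph. -/
lemma excess_pow_three_le [Fintype G.edgeSet] (hG : G.Connected) {g : V → ℝ} (h0 : ∀ w, 0 ≤ g w)
    (h1 : ∑ w, g w = 1) : excess g ^ 3 ≤ 8 * ∑ e : G.edgeSet, sqDiff g e := by
  classical
  have : Nonempty V := hG.nonempty
  have hn : (0 : ℝ) < Fintype.card V := by exact_mod_cast Fintype.card_pos
  rcases (excess_nonneg h1).eq_or_lt with hS | hS
  · rw [← hS]
    have := Finset.sum_nonneg (s := Finset.univ)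
      (fun (e : G.edgeSet) _ => sqDiff_nonneg g (e : Sym2 V))
    linarith
  set S := excess g with hSdef
  obtain ⟨x, hx⟩ := Finite.exists_max g
  obtain ⟨z, hz⟩ := Finite.exists_min g
  have hzn : g z ≤ 1 / Fintype.card V := by
    rw [le_div_iff₀ hn, ← h1]
    have := Finset.card_nsmul_le_sum Finset.univ g (g z) (fun w _ => hz w)
    simp at this; linarith
  -- For a probability vector the maximum is at least the sum of squares.
  have hM : S + 1 / Fintype.card V ≤ g x := by
    have : ∑ w, g w ^ 2 ≤ ∑ w, g w * g x :=
      Finset.sum_le_sum fun w _ => by rw [sq]; exact mul_le_mul_of_nonneg_left (hx w) (h0 w)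
    rw [← Finset.sum_mul, h1] at this
    simp only [hSdef, excess]; linarith
  have hnpos : 0 < 1 / (Fintype.card V : ℝ) := by positivity
  -- Take `y` nearest to the maximum `x` among the vertices where `g` has dropped by `S / 2`; the
  -- minimum `z` is one of them. Before `y`, a geodesic carries mass at least `S / 2` per vertex, so
  -- its length is at most `2 / S`. Cauchy–Schwarz along it then gives `S ^ 2 / 4 ≤ (2 / S) * D`,
  -- with `D` the sum of squared differences over all edges.
  obtain ⟨y, hy, hymin⟩ := Finset.exists_min_image
    (Finset.univ.filter fun w => g w ≤ g x - S / 2) (fun w => G.dist x w)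
    ⟨z, by simp; linarith⟩
  simp only [Finset.mem_filter, Finset.mem_univ, true_and] at hy hymin
  obtain ⟨p, hp, hlen⟩ := hG.exists_path_of_dist x y
  have hbig : ∀ w ∈ p.support, w ≠ y → S / 2 ≤ g w := by
    intro w hw hwy
    by_contra hlt
    push Not at hlt
    have hd := hymin w (by linarith)
    have hlt' := p.length_takeUntil_lt_length hw hwy
    have := SimpleGraph.dist_le (p.takeUntil w hw)
    omega
  have hL : (p.length : ℝ) * (S / 2) ≤ 1 := by
    have hcard : (p.support.toFinset.erase y).card = p.length := by
      rw [Finset.card_erase_of_mem (by simp), List.toFinset_card_of_nodup hp.support_nodup,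
        p.length_support]; simp
    have h2 : (p.support.toFinset.erase y).card • (S / 2) ≤ ∑ w ∈ p.support.toFinset.erase y, g w :=
      Finset.card_nsmul_le_sum _ _ _ (fun w hw => by
        simp only [Finset.mem_erase, List.mem_toFinset] at hw
        exact hbig w hw.2 hw.1)
    have h3 := Finset.sum_le_univ_sum_of_nonneg h0 (s := p.support.toFinset.erase y)
    rw [hcard, nsmul_eq_mul] at h2
    linarith
  have hE : (p.edges.map (sqDiff g)).sum ≤ ∑ e : G.edgeSet, sqDiff g e := by
    rw [← List.sum_toFinset _ hp.isTrail.edges_nodup,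
      ← Finset.sum_subtype (p := (· ∈ G.edgeSet)) G.edgeFinset (by simp) (sqDiff g)]
    refine Finset.sum_le_sum_of_subset_of_nonneg ?_ (fun e _ _ => sqDiff_nonneg g e)
    intro e he
    simp only [List.mem_toFinset] at he
    simpa using p.edges_subset_edgeSet he
  have hpath := sq_sub_le_length_mul_sum_sqDiff g p
  set D := ∑ e : G.edgeSet, sqDiff g e
  have hl0 : (0 : ℝ) ≤ p.length := Nat.cast_nonneg _
  have h4 : (S / 2) ^ 2 ≤ p.length * D :=
    (pow_le_pow_left₀ (by linarith) (by linarith) 2).trans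
      (hpath.trans (mul_le_mul_of_nonneg_left hE hl0))
  have hD : 0 ≤ D := Finset.sum_nonneg (fun e _ => sqDiff_nonneg g e)
  nlinarith [mul_le_mul_of_nonneg_right hL hD, mul_le_mul_of_nonneg_right h4 hS.le]

end Averaging

/-! ### Duality, and decay of the excess under fragmentation -/

section Fragmentation

variable {V : Type u} {G : SimpleGraph V}

/-- The fragmentation process dual to the averaging along `σ`: the last averaging is applied
first. -/
noncomputable def fragment : (K : ℕ) → (Fin K → Option G.edgeSet) → (V → ℝ) → V → ℝ
  | 0, _, g => g
  | K + 1, σ, g => avgStep (σ 0) (fragment K (Fin.tail σ) g)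

lemma fragment_nonneg {K : ℕ} (σ : Fin K → Option G.edgeSet) {g : V → ℝ} (hg : ∀ w, 0 ≤ g w) :
    ∀ w, 0 ≤ fragment K σ g w := by
  induction K with
  | zero => exact hg
  | succ K ih => exact avgStep_nonneg _ (ih _)

variable [Fintype V]

lemma sum_fragment {K : ℕ} (σ : Fin K → Option G.edgeSet) (g : V → ℝ) :
    ∑ w, fragment K σ g w = ∑ w, g w := by
  induction K with
  | zero => rfl
  | succ K ih => rw [fragment, sum_avgStep, ih]

/-- Moving the averagings one at a time onto the test vector by self-adjointness reverses their
order. -/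
lemma sum_mul_eq_sum_fragment_mul {K : ℕ} (σ : Fin K → Option G.edgeSet) (g : V → ℝ)
    (x : ℕ → V → ℝ) (hx : ∀ k : Fin K, x (k + 1) = avgStep (σ k) (x k)) :
    ∑ w, g w * x K w = ∑ w, fragment K σ g w * x 0 w := by
  induction K generalizing x with
  | zero => rfl
  | succ K ih =>
    have h := ih (Fin.tail σ) (fun k => x (k + 1)) (fun k => by
      simpa [Fin.tail] using hx k.succ)
    rw [h, fragment, sum_avgStep_mul_comm]
    have h0 := hx 0
    simp only [Fin.val_zero, zero_add] at h0 ⊢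
    rw [h0]

lemma one_sub_exp_neg_sum_le {ι : Type*} (s : Finset ι) {a : ι → ℝ} (ha : ∀ i ∈ s, 0 ≤ a i) :
    1 - Real.exp (-∑ i ∈ s, a i) ≤ ∑ i ∈ s, (1 - Real.exp (-a i)) := by
  classical
  induction s using Finset.induction_on with
  | empty => simp
  | insert i s hi ih =>
    rw [Finset.sum_insert hi, Finset.sum_insert hi, neg_add, Real.exp_add]
    have h1 := ih (fun j hj => ha j (Finset.mem_insert_of_mem hj))
    have h2 : Real.exp (-a i) ≤ 1 := Real.exp_le_one_iff.2 (by linarith [ha i (by simp)])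
    have h3 : Real.exp (-∑ j ∈ s, a j) ≤ 1 := Real.exp_le_one_iff.2 (by
      linarith [Finset.sum_nonneg (fun j hj => ha j (Finset.mem_insert_of_mem hj))])
    nlinarith [mul_nonneg (sub_nonneg.2 h2) (sub_nonneg.2 h3)]

/-- The Lyapunov function `exp (-8 / S ^ 2)` of the excess `S`. -/
noncomputable def lyapunov (g : V → ℝ) : ℝ :=
  -- The value `0` is the limit as the excess tends to `0`; division by zero would give `exp 0 = 1`
  -- instead.
  if excess g ≤ 0 then 0 else Real.exp (-(8 / excess g ^ 2))

lemma lyapunov_nonneg (g : V → ℝ) : 0 ≤ lyapunov g := by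
  unfold lyapunov; split_ifs <;> positivity

lemma lyapunov_le_one (g : V → ℝ) : lyapunov g ≤ 1 := by
  unfold lyapunov
  split_ifs
  · exact zero_le_one
  · exact Real.exp_le_one_iff.2 (neg_nonpos.2 (by positivity))

/-- The excess drops by `d / 2`, with `d` the squared difference across `e`, and the convex function
`8 / S ^ 2` lies above its tangent, so the exponent gains at least `8 * d / S ^ 3`. -/
lemma lyapunov_avgStep_some_le (e : G.edgeSet) (g : V → ℝ) :
    lyapunov (avgStep (some e) g) ≤
      lyapunov g * Real.exp (-(8 * sqDiff g e / excess g ^ 3)) := by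
  have hE := excess_avgStep_some e g
  have hd := sqDiff_nonneg g (e : Sym2 V)
  by_cases h : excess (avgStep (some e) g) ≤ 0
  · rw [lyapunov, if_pos h]
    exact mul_nonneg (lyapunov_nonneg g) (Real.exp_nonneg _)
  · have h' : ¬ excess g ≤ 0 := by intro h'; apply h; linarith
    rw [lyapunov, if_neg h, lyapunov, if_neg h', ← Real.exp_add, Real.exp_le_exp]
    push Not at h h'
    rw [hE] at h ⊢
    set S := excess g
    set d := sqDiff g (e : Sym2 V)
    have hS' : 0 < S - d / 2 := h
    have : 8 / S ^ 2 + 8 * d / S ^ 3 ≤ 8 / (S - d / 2) ^ 2 := by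
      rw [show 8 / S ^ 2 + 8 * d / S ^ 3 = 8 * (S + d) / S ^ 3 by field_simp,
        div_le_div_iff₀ (by positivity) (by positivity)]
      nlinarith [mul_nonneg (sq_nonneg d) (show 0 ≤ 3 * S - d by linarith)]
    linarith

variable [Fintype G.edgeSet]

/-- The probability that, during a time interval of length `h`, no clock rings (`none`), or exactly
one clock rings, once, and it is that of `e` (`some e`). -/
noncomputable def stepWeight (G : SimpleGraph V) [Fintype G.edgeSet] (h : ℝ) (a : Option G.edgeSet) :
    ℝ :=
  Real.exp (-(Fintype.card G.edgeSet * h)) * if a = none then 1 else h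

omit [Fintype V] in
lemma stepWeight_nonneg {h : ℝ} (hh : 0 ≤ h) (a : Option G.edgeSet) : 0 ≤ stepWeight G h a := by
  unfold stepWeight; split_ifs <;> positivity

/-- By the Nash inequality the exponents gained over all edges sum to at least `1`. Subadditivity of
`1 - exp (-x)` then makes the relative losses sum to at least `1 - 1 / e ≥ 1 / 2`, whatever their
distribution over the edges. -/
lemma sum_stepWeight_mul_lyapunov_le (hG : G.Connected) {h : ℝ} (hh : 0 ≤ h) {g : V → ℝ}
    (h0 : ∀ w, 0 ≤ g w) (h1 : ∑ w, g w = 1) :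
    ∑ a, stepWeight G h a * lyapunov (avgStep a g) ≤ Real.exp (-(h / 2)) * lyapunov g := by
  have hL := lyapunov_nonneg g
  set m : ℝ := (Fintype.card G.edgeSet : ℝ)
  have key : ∑ e : G.edgeSet, lyapunov (avgStep (some e) g) ≤ lyapunov g * (m - 1 / 2) := by
    by_cases hS : excess g ≤ 0
    · have : lyapunov g = 0 := by rw [lyapunov, if_pos hS]
      rw [this, zero_mul]
      refine Finset.sum_nonpos fun e _ => ?_
      have := lyapunov_avgStep_some_le e g
      simpa [‹lyapunov g = 0›] using this
    push Not at hS
    have ha : 1 ≤ ∑ e : G.edgeSet, 8 * sqDiff g e / excess g ^ 3 := by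
      rw [← Finset.sum_div, ← Finset.mul_sum, le_div_iff₀ (by positivity), one_mul]
      exact excess_pow_three_le hG h0 h1
    have hb := one_sub_exp_neg_sum_le Finset.univ (a := fun e : G.edgeSet =>
      8 * sqDiff g e / excess g ^ 3) (fun e _ => by
        have := sqDiff_nonneg g (e : Sym2 V); positivity)
    have hc : Real.exp (-∑ e : G.edgeSet, 8 * sqDiff g e / excess g ^ 3) ≤ 1 / 2 := by
      refine (Real.exp_le_exp.2 (neg_le_neg ha)).trans ?_
      rw [Real.exp_neg, ← one_div]
      exact one_div_le_one_div_of_le two_pos (by linarith [Real.add_one_le_exp (1 : ℝ)])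
    rw [Finset.sum_sub_distrib] at hb
    simp only [Finset.sum_const, Finset.card_univ, nsmul_eq_mul, mul_one] at hb
    refine (Finset.sum_le_sum fun e _ => lyapunov_avgStep_some_le e g).trans ?_
    rw [← Finset.mul_sum]
    refine mul_le_mul_of_nonneg_left ?_ hL
    linarith
  rw [Fintype.sum_option]
  simp only [stepWeight, avgStep_none, if_true, reduceCtorEq, if_false, mul_one]
  rw [← Finset.mul_sum]
  have he : Real.exp (-(h / 2)) = Real.exp (-(m * h)) * Real.exp (h * (m - 1 / 2)) := by
    rw [← Real.exp_add]; congr 1; ring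
  rw [he]
  have h2 : 1 + h * (m - 1 / 2) ≤ Real.exp (h * (m - 1 / 2)) := by
    linarith [Real.add_one_le_exp (h * (m - 1 / 2))]
  have hE := (Real.exp_pos (-(m * h))).le
  calc _ = Real.exp (-(m * h)) *
        (lyapunov g + h * ∑ e : G.edgeSet, lyapunov (avgStep (some e) g)) := by ring
    _ ≤ Real.exp (-(m * h)) * (lyapunov g * (1 + h * (m - 1 / 2))) := by
        refine mul_le_mul_of_nonneg_left ?_ hE
        nlinarith [mul_le_mul_of_nonneg_left key hh]
    _ ≤ Real.exp (-(m * h)) * (lyapunov g * Real.exp (h * (m - 1 / 2))) := by gcongr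
    _ = _ := by ring

/-- The probability of the step sequence `σ`. -/
noncomputable def seqWeight (h : ℝ) {K : ℕ} (σ : Fin K → Option G.edgeSet) : ℝ :=
  ∏ k, stepWeight G h (σ k)

omit [Fintype V] in
lemma seqWeight_nonneg {h : ℝ} (hh : 0 ≤ h) {K : ℕ} (σ : Fin K → Option G.edgeSet) :
    0 ≤ seqWeight h σ := Finset.prod_nonneg fun _ _ => stepWeight_nonneg hh _

omit [Fintype V] in
lemma sum_seqWeight (h : ℝ) (K : ℕ) :
    ∑ σ : Fin K → Option G.edgeSet, seqWeight h σ =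
      ((1 + Fintype.card G.edgeSet * h) * Real.exp (-(Fintype.card G.edgeSet * h))) ^ K := by
  classical
  have := Finset.prod_univ_sum (fun _ : Fin K => (Finset.univ : Finset (Option G.edgeSet)))
    (fun _ a => stepWeight G h a)
  rw [Fintype.piFinset_univ] at this
  unfold seqWeight
  rw [← this, Finset.prod_const, Finset.card_univ, Fintype.card_fin, Fintype.sum_option]
  congr 1
  simp [stepWeight]
  ring

lemma sum_seqWeight_mul_lyapunov_le (hG : G.Connected) {h : ℝ} (hh : 0 ≤ h) (K : ℕ) {g : V → ℝ}
    (h0 : ∀ w, 0 ≤ g w) (h1 : ∑ w, g w = 1) :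
    ∑ σ : Fin K → Option G.edgeSet, seqWeight h σ * lyapunov (fragment K σ g) ≤
      Real.exp (-(K * h / 2)) := by
  induction K with
  | zero => simpa [seqWeight, fragment] using lyapunov_le_one g
  | succ K ih =>
    -- Split off `σ 0`: the fragmentation applies it last, so the one-step bound applies with the
    -- tail fixed.
    rw [← (Fin.consEquiv fun _ => Option G.edgeSet).sum_comp, Fintype.sum_prod_type_right]
    simp only [Fin.consEquiv_apply, seqWeight, Fin.prod_univ_succ, Fin.cons_zero, Fin.cons_succ,
      fragment]
    calc _ = ∑ τ : Fin K → Option G.edgeSet, seqWeight h τ *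
          ∑ a, stepWeight G h a * lyapunov (avgStep a (fragment K τ g)) := by
          refine Finset.sum_congr rfl fun τ _ => ?_
          rw [Finset.mul_sum]
          refine Finset.sum_congr rfl fun a _ => ?_
          have : Fin.tail ((Fin.consEquiv fun _ => Option G.edgeSet) (a, τ)) = τ := Fin.tail_cons _ _
          rw [seqWeight, this]; ring
      _ ≤ ∑ τ : Fin K → Option G.edgeSet, seqWeight h τ *
          (Real.exp (-(h / 2)) * lyapunov (fragment K τ g)) := by
          refine Finset.sum_le_sum fun τ _ => mul_le_mul_of_nonneg_left ?_ (seqWeight_nonneg hh τ)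
          exact sum_stepWeight_mul_lyapunov_le hG hh (fragment_nonneg τ h0)
            ((sum_fragment τ g).trans h1)
      _ = Real.exp (-(h / 2)) * ∑ τ : Fin K → Option G.edgeSet, seqWeight h τ *
          lyapunov (fragment K τ g) := by
          rw [Finset.mul_sum]; refine Finset.sum_congr rfl fun τ _ => by ring
      _ ≤ Real.exp (-(h / 2)) * Real.exp (-(K * h / 2)) := by gcongr
      _ = _ := by rw [← Real.exp_add]; congr 1; push_cast; ring

/-- After total time `t = K * h`, the excess of the fragmentation is at most `√(32 / t)` up to an
event of exponentially small weight. -/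
lemma sum_seqWeight_excess_gt_le (hG : G.Connected) {t h : ℝ} (ht : 0 < t) {K : ℕ}
    (hK : K * h = t) (hh : 0 ≤ h) {g : V → ℝ} (h0 : ∀ w, 0 ≤ g w) (h1 : ∑ w, g w = 1) :
    ∑ σ : Fin K → Option G.edgeSet with √(32 / t) < excess (fragment K σ g), seqWeight h σ ≤
      Real.exp (-(t / 4)) := by
  have hmain := sum_seqWeight_mul_lyapunov_le (G := G) hG hh K h0 h1
  -- Markov's inequality: on this event `8 / S ^ 2 < t / 4`, so `lyapunov` is at least `exp (-t /
  -- 4)`, while its weighted sum is at most `exp (-t / 2)`.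
  have hle : ∑ σ : Fin K → Option G.edgeSet with √(32 / t) < excess (fragment K σ g),
      seqWeight h σ * Real.exp (-(t / 4)) ≤ Real.exp (-(K * h / 2)) := by
    refine le_trans (Finset.sum_le_sum fun σ hσ => ?_) ((Finset.sum_le_univ_sum_of_nonneg
      fun σ => mul_nonneg (seqWeight_nonneg hh σ) (lyapunov_nonneg _)).trans hmain)
    refine mul_le_mul_of_nonneg_left ?_ (seqWeight_nonneg hh σ)
    simp only [Finset.mem_filter, Finset.mem_univ, true_and] at hσ
    have hpos : 0 < excess (fragment K σ g) := (Real.sqrt_nonneg _).trans_lt hσ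
    rw [lyapunov, if_neg hpos.not_ge, Real.exp_le_exp, neg_le_neg_iff, div_le_iff₀ (by positivity)]
    have := (Real.sqrt_lt' hpos).1 hσ
    rw [div_lt_iff₀ ht] at this
    nlinarith
  rw [← Finset.sum_mul, hK] at hle
  have h2 : Real.exp (-(t / 2)) = Real.exp (-(t / 4)) * Real.exp (-(t / 4)) := by
    rw [← Real.exp_add]; congr 1; ring
  rw [h2] at hle
  exact le_of_mul_le_mul_right hle (Real.exp_pos _)

end Fragmentation

/-! ### From counting paths to averaging steps -/

section Trajectories

lemma not_mem_ringTimes_of_eq {k : ℝ≥0 → ℕ} {s r : ℝ≥0} (hsr : s < r) (h : k s = k r) :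
    r ∉ ringTimes k := fun hr => hr.2 s hsr h

/-- The ring time is the infimum of the times at which `k` exceeds `k s`; right-continuity into a
discrete space makes it attained. -/
lemma exists_unique_ring {k : ℝ≥0 → ℕ} (hm : Monotone k)
    (hr : ∀ t, ContinuousWithinAt k (Set.Ici t) t) {s t : ℝ≥0} (h : k t = k s + 1) :
    ∃ r ∈ Set.Ioc s t, r ∈ ringTimes k ∧ ∀ q ∈ Set.Ioc s t, q ∈ ringTimes k → q = r := by
  set A : Set ℝ≥0 := {q | k s + 1 ≤ k q}
  have htA : t ∈ A := h.ge
  set r := sInf A with hrdef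
  have hbd : BddBelow A := OrderBot.bddBelow A
  have hrt : r ≤ t := csInf_le hbd htA
  have hrA : k s + 1 ≤ k r := by
    by_contra hlt
    have hev : ∀ᶠ q in 𝓝[≥] r, k q = k r := by
      have := hr r
      rw [ContinuousWithinAt, nhds_discrete, tendsto_pure] at this
      exact this
    have hlt' : r < t := lt_of_le_of_ne hrt (fun he => hlt (he ▸ htA))
    obtain ⟨q, hq, hqs⟩ := (mem_nhdsGE_iff_exists_Ico_subset' hlt').1 hev
    obtain ⟨a, haA, haq⟩ := exists_lt_of_csInf_lt ⟨t, htA⟩ (show sInf A < q from hq)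
    have := hqs ⟨csInf_le hbd haA, haq⟩
    simp only [Set.mem_ofPred_eq] at this
    exact hlt (this ▸ haA)
  have hsr : s < r := by
    by_contra hle
    have := hm (not_lt.1 hle)
    omega
  have hbelow : ∀ q < r, k q ≤ k s := by
    intro q hq
    by_contra hlt
    exact absurd (csInf_le hbd (show q ∈ A by simp only [A, Set.mem_ofPred_eq]; omega)) (not_le.2 hq)
  refine ⟨r, ⟨hsr, hrt⟩, ⟨pos_of_gt hsr, fun q hq => ?_⟩, fun q hq hqr => ?_⟩
  · have := hbelow q hq; omega
  · rcases lt_trichotomy q r with hlt | heq | hgt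
    · have := hbelow q hlt
      have := hm hq.1.le
      exact absurd hqr (not_mem_ringTimes_of_eq hq.1 (by omega))
    · exact heq
    · have := hm hq.2
      have := hm hgt.le
      exact absurd hqr (not_mem_ringTimes_of_eq hgt (by omega))

open Classical in
/-- One time step of the averaging dynamics in which at most one clock rings, at most once. -/
lemma IsAveragingPath.eq_avgStep {V : Type u} {G : SimpleGraph V} {k : G.edgeSet → ℝ≥0 → ℕ}
    {x : ℝ≥0 → V → ℝ} (hx : IsAveragingPath G (fun e => ringTimes (k e)) x)
    (hm : ∀ e, Monotone (k e)) (hr : ∀ e t, ContinuousWithinAt (k e) (Set.Ici t) t)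
    {s t : ℝ≥0} (hst : s ≤ t) (a : Option G.edgeSet)
    (ha : ∀ e, k e t - k e s = if a = some e then 1 else 0) :
    x t = avgStep a (x s) := by
  have hno : ∀ e, a ≠ some e → ∀ r ∈ Set.Ioc s t, r ∉ ringTimes (k e) := by
    intro e he r hrm
    have h1 := ha e
    rw [if_neg he] at h1
    have h2 := hm e hrm.1.le
    have h3 := hm e hrm.2
    exact not_mem_ringTimes_of_eq hrm.1 (by omega)
  rcases a with _ | ⟨e, he⟩
  · funext w
    exact hx.const w s t hst fun e _ => hno e (by simp)
  · induction e with | _ y z =>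
    set E : G.edgeSet := ⟨s(y, z), he⟩
    have hadj : G.Adj y z := he
    have h1 : k E t = k E s + 1 := by
      have h1 := ha E
      rw [if_pos rfl] at h1
      omega
    obtain ⟨r, hrst, hring, huniq⟩ := exists_unique_ring (hm E) (hr E) h1
    have hbefore : ∀ w, ∀ q ∈ Set.Ico s r, x q w = x s w := by
      intro w q hq
      refine hx.const w s q hq.1 fun e _ p hp hpe => ?_
      by_cases hE : e = E
      · subst hE
        have := huniq p ⟨hp.1, hp.2.trans (hq.2.le.trans hrst.2)⟩ hpe
        exact absurd (hp.2.trans_lt hq.2) (by rw [this]; exact lt_irrefl _)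
      · exact hno e (by simpa using Ne.symm hE) p ⟨hp.1, hp.2.trans (hq.2.le.trans hrst.2)⟩ hpe
    have hafter : ∀ w, x t w = x r w := by
      intro w
      refine hx.const w r t hrst.2 fun e _ p hp hpe => ?_
      by_cases hE : e = E
      · subst hE
        have := huniq p ⟨hrst.1.trans hp.1, hp.2⟩ hpe
        exact absurd hp.1 (by rw [this]; exact lt_irrefl _)
      · exact hno e (by simpa using Ne.symm hE) p ⟨hrst.1.trans hp.1, hp.2⟩ hpe
    have hneBot : (𝓝[<] r).NeBot := nhdsLT_neBot_of_exists_lt ⟨s, hrst.1⟩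
    -- Opinions are frozen on `[s, r)`, so the left limits at the ring are the values at `s`.
    have hlim : ∀ w c, Tendsto (fun q => x q w) (𝓝[<] r) (𝓝 c) → c = x s w := by
      intro w c hc
      refine tendsto_nhds_unique hc (tendsto_const_nhds.congr' ?_)
      filter_upwards [Ico_mem_nhdsLT hrst.1] with q hq using (hbefore w q hq).symm
    obtain ⟨c, d, hc, hd, hy, hz⟩ := hx.update y z hadj r hring
    rw [hlim y c hc, hlim z d hd] at hy hz
    funext w
    simp only [avgStep, E, Sym2.mem_iff, edgeMean_mk]
    split_ifs with hw
    · rcases hw with rfl | rfl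
      · rw [hafter, hy]
      · rw [hafter, hz]
    · refine hx.const w s t hst fun e hwe p hp => ?_
      refine hno e (fun hE => hw ?_) p hp
      have : e = E := by simpa using hE.symm
      subst this
      simpa [E] using hwe

end Trajectories

/-! ### Probabilities of step sequences -/

section Clocks

variable {V : Type u} {Ω : Type v} [MeasurableSpace Ω] {G : SimpleGraph V} {P : Measure Ω}
  {N : G.edgeSet → ℝ≥0 → Ω → ℕ}

open Classical in
/-- The clock paths for which, in the `k`-th time interval of length `h`, the clock of `σ k` rings
exactly once and all other clocks are silent. -/
def stepPaths (h : ℝ≥0) {K : ℕ} (σ : Fin K → Option G.edgeSet) : Set (G.edgeSet → ℝ≥0 → ℕ) :=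
  {c | ∀ e, ∀ k : Fin K, c e ((k + 1 : ℕ) * h) - c e (k * h) = if σ k = some e then 1 else 0}

lemma measurableSet_stepPaths [Countable G.edgeSet] (h : ℝ≥0) {K : ℕ}
    (σ : Fin K → Option G.edgeSet) : MeasurableSet (stepPaths h σ) := by
  simp only [stepPaths, Set.ofPred_forall]
  refine MeasurableSet.iInter fun e => MeasurableSet.iInter fun k => ?_
  have : Measurable fun c : G.edgeSet → ℝ≥0 → ℕ => c e ((k + 1 : ℕ) * h) - c e (k * h) := by
    fun_prop
  exact this (measurableSet_singleton _)

lemma IsUnitPoissonProcess.measureReal_increments_eq {N : ℝ≥0 → Ω → ℕ}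
    (hN : IsUnitPoissonProcess N P) (h : ℝ≥0) {K : ℕ} (b : Fin K → ℕ) :
    P.real {ω | ∀ k : Fin K, N ((k + 1 : ℕ) * h) ω - N (k * h) ω = b k} =
      ∏ k, (Real.exp (-h) * h ^ b k / (b k).factorial) := by
  have hmono : Monotone fun k : ℕ => (k : ℝ≥0) * h := fun i j hij => by
    simp only; gcongr
  have hind := (hN.indep_increments.nat hmono).precomp (g := fun k : Fin K => (k : ℕ))
    Fin.val_injective
  have hset : {ω | ∀ k : Fin K, N ((k + 1 : ℕ) * h) ω - N (k * h) ω = b k} =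
      ⋂ k : Fin K, (fun ω => N ((k + 1 : ℕ) * h) ω - N (k * h) ω) ⁻¹' {b k} := by
    ext ω; simp
  rw [hset, measureReal_def, hind.meas_iInter (fun k => ⟨{b k}, measurableSet_singleton _, rfl⟩),
    ENNReal.toReal_prod]
  refine Finset.prod_congr rfl fun k _ => ?_
  have hlaw := hN.law_increments (k * h) ((k + 1 : ℕ) * h) (hmono (Nat.le_succ _))
  have := hlaw.measureReal_eq (p := fun j => j = b k) (measurableSet_singleton _)
  have hd : ((k + 1 : ℕ) : ℝ≥0) * h - k * h = h := by
    push_cast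
    rw [add_mul, one_mul, add_tsub_cancel_left]
  rw [hd] at this
  refine this.trans ?_
  exact poissonMeasure_real_singleton h (b k)

/-- Independence factorises the probability over edges and over intervals; regrouped by interval,
each silent clock contributes `exp (-h)` and the ringing one `exp (-h) * h`. -/
lemma measureReal_stepPaths [Fintype G.edgeSet] (hN : ∀ e, IsUnitPoissonProcess (N e) P)
    (hind : iIndepFun (fun e ω t => N e t ω) P) (h : ℝ≥0) {K : ℕ} (σ : Fin K → Option G.edgeSet) :
    P.real ((fun ω e t => N e t ω) ⁻¹' stepPaths h σ) = seqWeight (h : ℝ) σ := by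
  classical
  have hset : (fun ω e t => N e t ω) ⁻¹' stepPaths h σ = ⋂ e, (fun ω t => N e t ω) ⁻¹'
      {c | ∀ k : Fin K, c ((k + 1 : ℕ) * h) - c (k * h) = if σ k = some e then 1 else 0} := by
    ext ω
    simp [stepPaths]
  rw [hset, measureReal_def, hind.meas_iInter (fun e => ⟨_, ?_, rfl⟩), ENNReal.toReal_prod]
  · have key : ∀ e, (P ((fun ω t => N e t ω) ⁻¹' {c | ∀ k : Fin K,
        c ((k + 1 : ℕ) * h) - c (k * h) = if σ k = some e then 1 else 0})).toReal =
        ∏ k, (Real.exp (-h) * if σ k = some e then (h : ℝ) else 1) := by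
      intro e
      refine ((hN e).measureReal_increments_eq h fun k => if σ k = some e then 1 else 0).trans ?_
      refine Finset.prod_congr rfl fun k _ => ?_
      split_ifs <;> simp
    rw [Finset.prod_congr rfl fun e _ => key e, Finset.prod_comm, seqWeight]
    refine Finset.prod_congr rfl fun k _ => ?_
    rw [Finset.prod_mul_distrib, Finset.prod_const, Finset.card_univ, ← Real.exp_nat_mul, stepWeight,
      mul_neg]
    congr 1
    rcases σ k with _ | e
    · simp
    · simp
  · simp only [Set.ofPred_forall]
    refine MeasurableSet.iInter fun k => ?_
    have : Measurable fun c : ℝ≥0 → ℕ => c ((k + 1 : ℕ) * h) - c (k * h) := by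
      fun_prop
    exact this (measurableSet_singleton _)

lemma pairwise_disjoint_stepPaths (h : ℝ≥0) (K : ℕ) :
    Pairwise (Function.onFun Disjoint fun σ : Fin K → Option G.edgeSet => stepPaths h σ) := by
  intro σ τ hne
  refine Set.disjoint_left.2 fun c hσ hτ => hne (funext fun k => ?_)
  refine Option.ext fun e => ?_
  have h1 := hσ e k
  have h2 := hτ e k
  rw [h1] at h2
  by_cases h3 : σ k = some e <;> by_cases h4 : τ k = some e <;> simp_all

lemma sum_seqWeight_le_one [Fintype G.edgeSet] {h : ℝ} (hh : 0 ≤ h) (K : ℕ) :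
    ∑ σ : Fin K → Option G.edgeSet, seqWeight h σ ≤ 1 := by
  rw [sum_seqWeight]
  refine pow_le_one₀ (by positivity) ?_
  rw [Real.exp_neg, ← div_eq_mul_inv, div_le_one (Real.exp_pos _), add_comm]
  exact Real.add_one_le_exp _

/-- The missing mass is that of two or more rings in one interval. It is bounded by `(1 + x) * exp
(-x) ≥ 1 - x ^ 2` and Bernoulli's inequality, and is `O(1 / K)` when `h = t / K`. -/
lemma one_sub_sum_seqWeight_le [Fintype G.edgeSet] {h : ℝ} (hh : 0 ≤ h) (K : ℕ)
    (hsmall : Fintype.card G.edgeSet * h ≤ 1) :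
    1 - ∑ σ : Fin K → Option G.edgeSet, seqWeight h σ ≤ K * (Fintype.card G.edgeSet * h) ^ 2 := by
  rw [sum_seqWeight]
  set x := Fintype.card G.edgeSet * h
  have hx : 0 ≤ x := by positivity
  have h1 : 1 + -x ^ 2 ≤ (1 + x) * Real.exp (-x) := by
    nlinarith [Real.add_one_le_exp (-x)]
  have h2 := one_add_mul_le_pow (show -2 ≤ -x ^ 2 by nlinarith) K
  have h3 := pow_le_pow_left₀ (show 0 ≤ 1 + -x ^ 2 by nlinarith) h1 K
  linarith

end Clocks

/-! ### Concentration of the opinions at a fixed time -/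

section Concentration

variable {V : Type u} [Fintype V] {Ω : Type v} [MeasurableSpace Ω] {P : Measure Ω}
  [IsProbabilityMeasure P]

/-- Hoeffding's inequality for weighted sums with total weight zero of i.i.d. variables. -/
lemma measureReal_le_sum_mul_le {X : V → Ω → ℝ} (hind : iIndepFun X P)
    (hid : ∀ w z, IdentDistrib (X w) (X z) P P) (hb : ∀ w, ∀ᵐ ω ∂P, |X w ω| ≤ 1)
    {d : V → ℝ} (hd : ∑ w, d w = 0) {c : ℝ} (hdc : ∑ w, d w ^ 2 ≤ c) {ε : ℝ} (hε : 0 < ε) :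
    P.real {ω | ε ≤ ∑ w, d w * X w ω} ≤ Real.exp (-(ε ^ 2 / (2 * c))) := by
  have hnn : 0 ≤ ∑ w, d w ^ 2 := Finset.sum_nonneg fun w _ => sq_nonneg _
  -- If `d = 0`, Hoeffding's bound degenerates to `exp 0` through division by zero, so this case is
  -- separate.
  rcases hnn.eq_or_lt with h0 | hpos
  · have hz : ∀ w, d w = 0 := fun w => by
      have := (Finset.sum_eq_zero_iff_of_nonneg fun w _ => sq_nonneg (d w)).1 h0.symm w
        (Finset.mem_univ w)
      simpa using this
    have : {ω | ε ≤ ∑ w, d w * X w ω} = ∅ := by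
      ext ω; simp [hz, hε]
    rw [this]
    simpa using Real.exp_nonneg _
  have hsub : ∀ w ∈ Finset.univ, HasSubgaussianMGF (fun ω => d w * (X w ω - ∫ ω, X w ω ∂P))
      (d w ^ 2).toNNReal P := by
    intro w _
    have hw : HasSubgaussianMGF (fun ω => X w ω - ∫ ω, X w ω ∂P) 1 P := by
      have h2 : ((‖(1 : ℝ) - (-1)‖₊ / 2) ^ 2 : ℝ≥0) = 1 := by
        ext; push_cast; norm_num
      rw [← h2]
      refine hasSubgaussianMGF_of_mem_Icc (hid w w).aemeasurable_fst ?_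
      filter_upwards [hb w] with ω hω using abs_le.1 hω
    convert hw.const_mul (d w) using 1
    exact (Real.toNNReal_of_nonneg (sq_nonneg _)).trans (mul_one (_ : ℝ≥0)).symm
  have hind' : iIndepFun (fun w ω => d w * (X w ω - ∫ ω, X w ω ∂P)) P :=
    hind.comp (fun w x => d w * (x - ∫ ω, X w ω ∂P)) (fun w => by fun_prop)
  have hmain := HasSubgaussianMGF.measure_sum_ge_le_of_iIndepFun hind' hsub hε.le
  -- The common mean cancels because the weights sum to zero.
  have hsum : ∀ ω, ∑ w, d w * (X w ω - ∫ ω, X w ω ∂P) = ∑ w, d w * X w ω := by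
    intro ω
    rcases isEmpty_or_nonempty V with hV | ⟨⟨v⟩⟩
    · simp
    have : ∀ w, ∫ ω, X w ω ∂P = ∫ ω, X v ω ∂P := fun w => (hid w v).integral_eq
    simp only [this, mul_sub, Finset.sum_sub_distrib, ← Finset.sum_mul, hd, zero_mul, sub_zero]
  simp only [hsum] at hmain
  refine hmain.trans (Real.exp_le_exp.2 ?_)
  have h3 : ((∑ w, (d w ^ 2).toNNReal : ℝ≥0) : ℝ) = ∑ w, d w ^ 2 := by
    rw [NNReal.coe_sum]
    exact Finset.sum_congr rfl fun w _ => Real.coe_toNNReal _ (sq_nonneg _)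
  rw [h3, neg_div, neg_le_neg_iff]
  gcongr

lemma excess_eq_sum_sq {g : V → ℝ} (h1 : ∑ w, g w = 1) :
    excess g = ∑ w, (g w - 1 / Fintype.card V) ^ 2 := by
  have : Nonempty V := by
    by_contra h
    rw [not_nonempty_iff] at h
    simp at h1
  have hn : (Fintype.card V : ℝ) ≠ 0 := by exact_mod_cast Fintype.card_ne_zero
  simp only [sub_sq, Finset.sum_add_distrib, Finset.sum_sub_distrib, ← Finset.sum_mul,
    ← Finset.mul_sum, h1, excess, Finset.sum_const, Finset.card_univ, nsmul_eq_mul]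
  field_simp
  ring

/-- Centring both vectors at the uniform one leaves excesses instead of full `ℓ²` norms, with no `1
/ n` term. -/
lemma sum_sub_sq_le {g k : V → ℝ} (hg : ∑ w, g w = 1) (hk : ∑ w, k w = 1) :
    ∑ w, (g w - k w) ^ 2 ≤ 2 * (excess g + excess k) := by
  rw [excess_eq_sum_sq hg, excess_eq_sum_sq hk, ← Finset.sum_add_distrib, Finset.mul_sum]
  refine Finset.sum_le_sum fun w _ => ?_
  nlinarith [sq_nonneg (g w - 1 / Fintype.card V + (k w - 1 / Fintype.card V))]

variable {G : SimpleGraph V} {N : G.edgeSet → ℝ≥0 → Ω → ℕ} {f : ℝ≥0 → V → Ω → ℝ}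

/-- The initial opinions for which the averaging along `σ` leaves two opinions at distance at
least `ε`. -/
def spreadOpinions (ε : ℝ) {K : ℕ} (σ : Fin K → Option G.edgeSet) : Set (V → ℝ) := by
  classical
  exact ⋃ p : V × V, {x | ε ≤ ∑ w,
    (fragment K σ (Pi.single p.1 1) w - fragment K σ (Pi.single p.2 1) w) * x w}

lemma measurableSet_spreadOpinions (ε : ℝ) {K : ℕ} (σ : Fin K → Option G.edgeSet) :
    MeasurableSet (spreadOpinions ε σ) :=
  MeasurableSet.iUnion fun _ => measurableSet_le measurable_const (by fun_prop)

-- Once the step sequence is fixed, duality turns a large oscillation into an event about the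
-- initial opinions alone, which is independent of the clocks.
omit [IsProbabilityMeasure P] in
lemma IsEdgeAveragingProcess.ae_mem_spreadOpinions [Nonempty V] (hf : IsEdgeAveragingProcess G N f P) (h : ℝ≥0)
    (K : ℕ) (ε : ℝ) : ∀ᵐ ω ∂P, ∀ σ : Fin K → Option G.edgeSet,
      (fun e t => N e t ω) ∈ stepPaths h σ → ε < osc (fun w => f (K * h) w ω) →
      (fun w => f 0 w ω) ∈ spreadOpinions ε σ := by
  classical
  have hpaths : ∀ᵐ ω ∂P, ∀ e, N e 0 ω = 0 ∧ Monotone (fun t => N e t ω) ∧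
    ∀ t, ContinuousWithinAt (fun s => N e s ω) (Set.Ici t) t :=
    ae_all_iff.2 fun e => (hf.poisson e).paths
  filter_upwards [hpaths, hf.dynamics] with ω hω hdyn σ hσ hosc
  have hrep : ∀ v, f (K * h) v ω = ∑ w, fragment K σ (Pi.single v 1) w * f 0 w ω := by
    intro v
    have := sum_mul_eq_sum_fragment_mul σ (Pi.single v 1) (fun k w => f (k * h) w ω) (fun k =>
      hdyn.eq_avgStep (fun e => (hω e).2.1) (fun e => (hω e).2.2)
        (by gcongr; exact Nat.le_succ _) (σ k) (fun e => by simpa using hσ e k))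
    simpa [Pi.single_apply] using this
  obtain ⟨⟨v, z⟩, hvz⟩ := exists_lt_of_lt_ciSup hosc
  simp only [spreadOpinions, Set.mem_iUnion, Set.mem_ofPred_eq, sub_mul, Finset.sum_sub_distrib,
    ← hrep]
  rcases le_total 0 (f (K * h) v ω - f (K * h) z ω) with h0 | h0
  · exact ⟨(v, z), by rw [abs_of_nonneg h0] at hvz; exact hvz.le⟩
  · exact ⟨(z, v), by rw [abs_of_nonpos h0] at hvz; simp only; linarith⟩

-- Union bound over ordered pairs; the weight vector of each difference has squared norm at most `4
-- * s`.
open Classical in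
lemma measureReal_spreadOpinions_le (hind : iIndepFun (fun w => f 0 w) P)
    (hid : ∀ w z, IdentDistrib (f 0 w) (f 0 z) P P) (hb : ∀ w, ∀ᵐ ω ∂P, |f 0 w ω| ≤ 1)
    {ε s : ℝ} (hε : 0 < ε) {K : ℕ} (σ : Fin K → Option G.edgeSet)
    (hs : ∀ v, excess (fragment K σ (Pi.single v 1)) ≤ s) :
    P.real ((fun ω w => f 0 w ω) ⁻¹' spreadOpinions ε σ) ≤
      (Fintype.card V : ℝ) ^ 2 * Real.exp (-(ε ^ 2 / (8 * s))) := by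
  classical
  have hone : ∀ v : V, ∑ w, fragment K σ (Pi.single v 1) w = 1 := fun v => by
    rw [sum_fragment]; simp
  rw [spreadOpinions, Set.preimage_iUnion]
  refine (measureReal_iUnion_fintype_le _).trans ?_
  have hcard : ((Fintype.card V : ℝ)) ^ 2 = (Finset.univ : Finset (V × V)).card := by
    rw [Finset.card_univ, Fintype.card_prod]; push_cast; ring
  rw [hcard, ← nsmul_eq_mul]
  refine Finset.sum_le_card_nsmul _ _ _ fun p _ => ?_
  rw [show 8 * s = 2 * (4 * s) by ring]
  refine measureReal_le_sum_mul_le hind hid hb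
    (d := fun w => fragment K σ (Pi.single p.1 1) w - fragment K σ (Pi.single p.2 1) w) ?_ ?_ hε
  · rw [Finset.sum_sub_distrib, hone, hone, sub_self]
  · refine (sum_sub_sq_le (hone _) (hone _)).trans ?_
    linarith [hs p.1, hs p.2]

lemma sum_seqWeight_mul_spreadOpinions_le [Fintype G.edgeSet] (hG : G.Connected)
    (hind : iIndepFun (fun w => f 0 w) P)
    (hid : ∀ w z, IdentDistrib (f 0 w) (f 0 z) P P) (hb : ∀ w, ∀ᵐ ω ∂P, |f 0 w ω| ≤ 1)
    {ε : ℝ} (hε : 0 < ε) {t h : ℝ} (ht : 0 < t) (hh : 0 ≤ h) {K : ℕ} (hK : K * h = t) :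
    ∑ σ : Fin K → Option G.edgeSet,
        seqWeight h σ * P.real ((fun ω w => f 0 w ω) ⁻¹' spreadOpinions ε σ) ≤
      Fintype.card V * Real.exp (-(t / 4)) +
        (Fintype.card V : ℝ) ^ 2 * Real.exp (-(ε ^ 2 / (8 * √(32 / t)))) := by
  classical
  set s := √(32 / t)
  set B := (Fintype.card V : ℝ) ^ 2 * Real.exp (-(ε ^ 2 / (8 * s)))
  have hB : 0 ≤ B := by positivity
  -- Use Hoeffding if all `n` fragmentations have small excess; otherwise the indicator sum exceeds
  -- the trivial bound `1`.
  have hterm : ∀ σ : Fin K → Option G.edgeSet,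
      P.real ((fun ω w => f 0 w ω) ⁻¹' spreadOpinions ε σ) ≤
        (∑ v : V, if s < excess (fragment K σ (Pi.single v 1)) then 1 else 0) + B := by
    intro σ
    by_cases hgood : ∀ v, excess (fragment K σ (Pi.single v 1)) ≤ s
    · refine (measureReal_spreadOpinions_le hind hid hb hε σ hgood).trans ?_
      exact le_add_of_nonneg_left (Finset.sum_nonneg fun v _ => by split_ifs <;> norm_num)
    · push Not at hgood
      obtain ⟨v, hv⟩ := hgood
      refine measureReal_le_one.trans ?_
      have := Finset.single_le_sum
        (f := fun v : V => if s < excess (fragment K σ (Pi.single v 1)) then (1 : ℝ) else 0)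
        (fun v _ => by split_ifs <;> norm_num) (Finset.mem_univ v)
      simp only [hv, if_true] at this
      linarith
  calc _ ≤ ∑ σ : Fin K → Option G.edgeSet, seqWeight h σ *
        ((∑ v : V, if s < excess (fragment K σ (Pi.single v 1)) then 1 else 0) + B) :=
        Finset.sum_le_sum fun σ _ => mul_le_mul_of_nonneg_left (hterm σ) (seqWeight_nonneg hh σ)
    _ = ∑ v : V, ∑ σ : Fin K → Option G.edgeSet with
          s < excess (fragment K σ (Pi.single v 1)), seqWeight h σ +
        (∑ σ : Fin K → Option G.edgeSet, seqWeight h σ) * B := by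
        simp only [mul_add, Finset.sum_add_distrib, Finset.mul_sum, Finset.sum_mul]
        rw [Finset.sum_comm]
        simp [Finset.sum_filter]
    _ ≤ ∑ v : V, Real.exp (-(t / 4)) + 1 * B := by
        gcongr with v
        · exact sum_seqWeight_excess_gt_le hG ht hK hh
            (fun w => by by_cases hw : w = v <;> simp [hw]) (by simp)
        · exact sum_seqWeight_le_one hh K
    _ = _ := by simp

/-- The tail bound for the oscillation at a fixed time. -/
lemma IsEdgeAveragingProcess.measureReal_osc_gt_le (hf : IsEdgeAveragingProcess G N f P)
    (hG : G.Connected) (hind : iIndepFun (fun w => f 0 w) P)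
    (hid : ∀ w z, IdentDistrib (f 0 w) (f 0 z) P P) (hb : ∀ w, ∀ᵐ ω ∂P, |f 0 w ω| ≤ 1)
    {ε : ℝ} (hε : 0 < ε) {t : ℝ≥0} (ht : 0 < t) :
    P.real {ω | ε < osc (fun w => f t w ω)} ≤ Fintype.card V * Real.exp (-(t / 4)) +
        (Fintype.card V : ℝ) ^ 2 * Real.exp (-(ε ^ 2 / (8 * √(32 / t)))) := by
  classical
  have : Nonempty V := hG.nonempty
  set R := Fintype.card V * Real.exp (-(t / 4 : ℝ)) +
        (Fintype.card V : ℝ) ^ 2 * Real.exp (-(ε ^ 2 / (8 * √(32 / t))))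
  set m : ℝ := (Fintype.card G.edgeSet : ℝ)
  -- This lower bound on `K` gives `K > 0` and `m * h ≤ 1` for `h = t / K`, as the estimate of the
  -- missing mass requires.
  have hbound : ∀ K : ℕ, m * t + 1 ≤ K →
      P.real {ω | ε < osc (fun w => f t w ω)} ≤ (m * t) ^ 2 / K + R := by
    intro K hK
    have hm : 0 ≤ m * t := by positivity
    have hK0 : (0 : ℝ) < K := by linarith
    have hK0' : (K : ℝ≥0) ≠ 0 := by exact_mod_cast hK0.ne'
    set h : ℝ≥0 := t / K
    have hKh : (K : ℝ≥0) * h = t := mul_div_cancel₀ t hK0'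
    have hKh' : (K : ℝ) * h = t := by exact_mod_cast hKh
    set clock : Ω → G.edgeSet → ℝ≥0 → ℕ := fun ω e t => N e t ω
    set init : Ω → V → ℝ := fun ω w => f 0 w ω
    have hclock : Measurable clock := by
      refine measurable_pi_iff.2 fun e => measurable_pi_iff.2 fun t => (hf.poisson e).measurable t
    have hms : ∀ σ : Fin K → Option G.edgeSet, MeasurableSet (clock ⁻¹' stepPaths h σ) :=
      fun σ => hclock (measurableSet_stepPaths h σ)
    have hsub : P.real {ω | ε < osc (fun w => f t w ω)} ≤
        P.real ((⋃ σ : Fin K → Option G.edgeSet, clock ⁻¹' stepPaths h σ)ᶜ ∪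
          ⋃ σ : Fin K → Option G.edgeSet,
            (clock ⁻¹' stepPaths h σ ∩ init ⁻¹' spreadOpinions ε σ)) := by
      refine ENNReal.toReal_mono (measure_ne_top _ _) (measure_mono_ae ?_)
      filter_upwards [hf.ae_mem_spreadOpinions h K ε] with ω hω hosc
      rw [hKh] at hω
      by_cases hmem : ω ∈ ⋃ σ : Fin K → Option G.edgeSet, clock ⁻¹' stepPaths h σ
      · obtain ⟨σ, hσ⟩ := Set.mem_iUnion.1 hmem
        exact Or.inr (Set.mem_iUnion.2 ⟨σ, hσ, hω σ hσ hosc⟩)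
      · exact Or.inl hmem
    have hcompl : P.real (⋃ σ : Fin K → Option G.edgeSet, clock ⁻¹' stepPaths h σ)ᶜ ≤
        (m * t) ^ 2 / K := by
      rw [probReal_compl_eq_one_sub (MeasurableSet.iUnion hms), measureReal_iUnion_fintype
        (fun σ τ hne => (pairwise_disjoint_stepPaths h K hne).preimage clock) hms]
      simp only [clock, measureReal_stepPaths hf.poisson hf.indep_clocks]
      refine (one_sub_sum_seqWeight_le h.coe_nonneg K ?_).trans_eq ?_
      · have : (h : ℝ) = t / K := by simp [h]
        rw [this, ← mul_div_assoc, div_le_one hK0]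
        linarith
      · change K * (m * h) ^ 2 = _
        rw [← hKh']; field_simp
    have hgood : P.real (⋃ σ : Fin K → Option G.edgeSet,
        (clock ⁻¹' stepPaths h σ ∩ init ⁻¹' spreadOpinions ε σ)) ≤ R := by
      refine (measureReal_iUnion_fintype_le _).trans ?_
      refine le_of_eq_of_le (Finset.sum_congr rfl fun σ _ => ?_)
        (sum_seqWeight_mul_spreadOpinions_le hG hind hid hb hε (by exact_mod_cast ht)
          h.coe_nonneg hKh')
      have h1 := hf.indep_initial.symm.measure_inter_preimage_eq_mul _ _
        (measurableSet_stepPaths h σ) (measurableSet_spreadOpinions ε σ)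
      rw [← measureReal_stepPaths hf.poisson hf.indep_clocks h σ]
      simp only [measureReal_def, clock, init]
      rw [← ENNReal.toReal_mul, h1]
    exact hsub.trans ((measureReal_union_le _ _).trans (add_le_add hcompl hgood))
  -- `R` does not depend on `K`, so the discretisation error disappears in the limit.
  have hlim : Tendsto (fun K : ℕ => (m * t) ^ 2 / (K : ℝ) + R) atTop (𝓝 (0 + R)) :=
    (tendsto_const_div_atTop_nhds_zero_nat _).add_const R
  rw [zero_add] at hlim
  refine ge_of_tendsto hlim ?_
  filter_upwards [eventually_ge_atTop ⌈m * t + 1⌉₊] with K hK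
  exact hbound K (Nat.ceil_le.1 hK)

end Concentration

/-! ### Expected consensus time -/

section ConsensusTime

-- Every grid time before the first one with small oscillation contributes `s`, so monotonicity of
-- the oscillation is not needed. If there is no such grid time, the sum is infinite.
open Classical in
lemma consensusTime_le_tsum {V : Type u} (x : ℝ≥0 → V → ℝ) (ε : ℝ) {s : ℝ≥0} (hs : 0 < s) :
    consensusTime x ε ≤ ∑' k : ℕ, if ε < osc (x (k * s)) then (s : ℝ≥0∞) else 0 := by
  by_cases h : ∃ k : ℕ, osc (x (k * s)) ≤ ε
  · have hspec := Nat.find_spec h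
    calc consensusTime x ε ≤ ((Nat.find h * s : ℝ≥0) : ℝ≥0∞) :=
          iInf₂_le (Nat.find h * s : ℝ≥0) hspec
      _ = ∑ k ∈ Finset.range (Nat.find h), if ε < osc (x (k * s)) then (s : ℝ≥0∞) else 0 := by
        rw [Finset.sum_congr rfl fun k hk =>
          if_pos (not_le.1 (Nat.find_min h (Finset.mem_range.1 hk)))]
        simp
      _ ≤ _ := ENNReal.sum_le_tsum _
  · push Not at h
    simp only [h, if_true]
    rw [ENNReal.tsum_const_eq_top_of_ne_zero (by exact_mod_cast hs.ne')]
    exact le_top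

lemma lintegral_consensusTime_le {V : Type u} {Ω : Type v} [MeasurableSpace Ω] {P : Measure Ω}
    [IsFiniteMeasure P] (f : ℝ≥0 → V → Ω → ℝ) (ε : ℝ) {s : ℝ≥0} (hs : 0 < s) {b : ℕ → ℝ}
    (hb : Summable b) (hP : ∀ k : ℕ, P.real {ω | ε < osc (fun w => f (k * s) w ω)} ≤ b k) :
    ∫⁻ ω, consensusTime (fun t w => f t w ω) ε ∂P ≤ ENNReal.ofReal (s * ∑' k, b k) := by
  -- Measurability of `f t` at positive times is not assumed; the measurable hull has the same
  -- measure.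
  set E : ℕ → Set Ω := fun k => toMeasurable P {ω | ε < osc (fun w => f (k * s) w ω)}
  have hE : ∀ k, MeasurableSet (E k) := fun k => measurableSet_toMeasurable _ _
  have hb0 : ∀ k, 0 ≤ b k := fun k => measureReal_nonneg.trans (hP k)
  calc _ ≤ ∫⁻ ω, ∑' k, (E k).indicator (fun _ => (s : ℝ≥0∞)) ω ∂P := by
        refine lintegral_mono fun ω => (consensusTime_le_tsum _ ε hs).trans ?_
        refine ENNReal.tsum_le_tsum fun k => ?_
        split_ifs with h
        · rw [Set.indicator_of_mem]
          exact subset_toMeasurable _ _ h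
        · exact zero_le
    _ = ∑' k, s * P (E k) := by
        rw [lintegral_tsum fun k => (measurable_const.indicator (hE k)).aemeasurable]
        simp [hE]
    _ ≤ ∑' k, ENNReal.ofReal (s * b k) := by
        refine ENNReal.tsum_le_tsum fun k => ?_
        rw [ENNReal.ofReal_mul s.coe_nonneg, ENNReal.ofReal_coe_nnreal, measure_toMeasurable,
          ← ofReal_measureReal]
        gcongr
        exact hP k
    _ = _ := by
        rw [← tsum_mul_left, ENNReal.ofReal_tsum_of_nonneg
          (fun k => mul_nonneg s.coe_nonneg (hb0 k)) (hb.mul_left _)]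

lemma lintegral_consensusTime_eq_zero {V : Type u} {Ω : Type v} [MeasurableSpace Ω] {P : Measure Ω}
    (f : ℝ≥0 → V → Ω → ℝ) (ε : ℝ) (h : ∀ᵐ ω ∂P, osc (fun w => f 0 w ω) ≤ ε) :
    ∫⁻ ω, consensusTime (fun t w => f t w ω) ε ∂P = 0 := by
  rw [lintegral_congr_ae (g := 0), Pi.zero_def, lintegral_zero]
  filter_upwards [h] with ω hω
  exact le_antisymm (iInf₂_le (0 : ℝ≥0) hω) zero_le

lemma exp_neg_sqrt_le {k : ℝ} (hk : 0 < k) : Real.exp (-√k) ≤ 24 / k ^ 2 := by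
  have h := Real.pow_div_factorial_le_exp (√k) (Real.sqrt_nonneg k) 4
  have h4 : √k ^ 4 = k ^ 2 := by
    rw [show (4 : ℕ) = 2 * 2 from rfl, pow_mul, Real.sq_sqrt hk.le]
  rw [h4] at h
  rw [Real.exp_neg, inv_le_comm₀ (Real.exp_pos _) (by positivity), inv_div]
  simpa [Nat.factorial] using h

/-- The tail bound at the times `32768 * k * (log n) ^ 2 / ε ^ 4`. -/
lemma tail_bound_le {n : ℕ} (hn : 2 ≤ n) {ε : ℝ} (hε : 0 < ε) (hε2 : ε < 2) {k : ℕ} (hk : 1 ≤ k)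
    {t : ℝ} (ht : t = k * (32768 * Real.log n ^ 2 / ε ^ 4)) :
    n * Real.exp (-(t / 4)) + (n : ℝ) ^ 2 * Real.exp (-(ε ^ 2 / (8 * √(32 / t)))) ≤
      48 / (k : ℝ) ^ 2 := by
  have hnpos : (0 : ℝ) < n := by positivity
  have hk1 : (1 : ℝ) ≤ k := by exact_mod_cast hk
  have hk0 : (0 : ℝ) < k := by linarith
  set l := Real.log n
  have hl : 1 / 2 ≤ l := by
    have h2 : Real.log 2 ≤ l := Real.log_le_log two_pos (by exact_mod_cast hn)
    linarith [Real.log_two_gt_d9]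
  have hexp : (n : ℝ) = Real.exp l := (Real.exp_log hnpos).symm
  have hsq1 : 1 ≤ √(k : ℝ) := Real.one_le_sqrt.2 hk1
  have hsqk : √(k : ℝ) ^ 2 = k := Real.sq_sqrt hk0.le
  have hε4 : ε ^ 4 ≤ 16 := by
    calc ε ^ 4 ≤ 2 ^ 4 := by gcongr
      _ = 16 := by norm_num
  -- Since `ε ^ 4 ≤ 16`, `t / 4 ≥ 512 * k * l ^ 2`, which dominates `l + √k`.
  have h1 : n * Real.exp (-(t / 4)) ≤ Real.exp (-√k) := by
    rw [hexp, ← Real.exp_add, Real.exp_le_exp]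
    have : k * (2048 * l ^ 2) ≤ t := by
      rw [ht]
      gcongr
      rw [le_div_iff₀ (by positivity)]
      nlinarith [sq_nonneg l]
    nlinarith [mul_le_mul hk1 hl (by norm_num) hk0.le]
  -- The constant is `32768 = 32 * 32 ^ 2`, making the exponent `4 * l * √k`: half absorbs `n ^ 2`,
  -- and the rest is at least `√k` because `l ≥ 1 / 2`.
  have hroot : ε ^ 2 / (8 * √(32 / t)) = 4 * l * √k := by
    have : √(32 / t) = ε ^ 2 / (32 * l * √k) := by
      rw [Real.sqrt_eq_iff_mul_self_eq (by rw [ht]; positivity) (by positivity), ht]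
      field_simp
      rw [hsqk]
      ring
    rw [this]
    field_simp
    norm_num
  have h2 : (n : ℝ) ^ 2 * Real.exp (-(ε ^ 2 / (8 * √(32 / t)))) ≤ Real.exp (-√k) := by
    rw [hroot, hexp, ← Real.exp_nat_mul, ← Real.exp_add, Real.exp_le_exp]
    push_cast
    nlinarith [mul_le_mul hsq1 hl (by norm_num) (by linarith)]
  have h3 := exp_neg_sqrt_le hk0
  calc _ ≤ 24 / (k : ℝ) ^ 2 + 24 / (k : ℝ) ^ 2 := by linarith
    _ = _ := by ring

end ConsensusTime

theorem mainTheorem1 :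
    ∃ C : ℝ, 0 < C ∧
      ∀ (V : Type u) [Fintype V] (G : SimpleGraph V), G.Connected →
      ∀ (Ω : Type v) [MeasurableSpace Ω] (P : Measure Ω) [IsProbabilityMeasure P]
        (N : G.edgeSet → ℝ≥0 → Ω → ℕ) (f : ℝ≥0 → V → Ω → ℝ),
        IsEdgeAveragingProcess G N f P →
        iIndepFun (fun w => f 0 w) P →
        (∀ w z, IdentDistrib (f 0 w) (f 0 z) P P) →
        (∀ w, ∀ᵐ ω ∂P, |f 0 w ω| ≤ 1) →
        ∀ ε : ℝ, 0 < ε →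
          ∫⁻ ω, consensusTime (fun t w => f t w ω) ε ∂P ≤
            ENNReal.ofReal (C * Real.log (Fintype.card V) ^ 2 / ε ^ 4) := by
  set b : ℕ → ℝ := fun k => if k = 0 then 1 else 48 / (k : ℝ) ^ 2
  have hb0 : ∀ k, 0 ≤ b k := fun k => by simp only [b]; split_ifs <;> positivity
  have hb : Summable b := by
    have h : Summable fun k : ℕ => 48 * (1 / (k : ℝ) ^ 2) :=
      (Real.summable_one_div_nat_pow.2 one_lt_two).mul_left 48
    refine (summable_nat_add_iff 1).1 (((summable_nat_add_iff 1).2 h).congr fun k => ?_)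
    simp [b, div_eq_mul_inv]
  have hbpos : 0 < ∑' k, b k := hb.tsum_pos hb0 0 (by simp [b])
  refine ⟨32768 * ∑' k, b k, by positivity, ?_⟩
  intro V _ G hG Ω _ P _ N f hf hind hid hbd ε hε
  have hV : Nonempty V := hG.nonempty
  -- With one vertex the logarithm vanishes, so the expectation must be exactly zero; for `ε ≥ 2`
  -- consensus also holds at time `0`.
  by_cases htriv : Fintype.card V < 2 ∨ 2 ≤ ε
  · rw [lintegral_consensusTime_eq_zero f ε ?_]
    · exact zero_le
    filter_upwards [ae_all_iff.2 hbd] with ω hω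
    refine ciSup_le fun p => ?_
    rcases htriv with hcard | hε2
    · have hsub : Subsingleton V := Fintype.card_le_one_iff_subsingleton.1 (by omega)
      rw [Subsingleton.elim p.1 p.2, sub_self, abs_zero]
      exact hε.le
    · have h1 := abs_le.1 (hω p.1)
      have h2 := abs_le.1 (hω p.2)
      exact (abs_le.2 ⟨by linarith, by linarith⟩ : _ ≤ (2 : ℝ)).trans hε2
  push Not at htriv
  obtain ⟨hn, hε2⟩ := htriv
  have hlog : 0 < Real.log (Fintype.card V) := Real.log_pos (by exact_mod_cast hn)
  have hs0 : 0 < 32768 * Real.log (Fintype.card V) ^ 2 / ε ^ 4 := by positivity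
  set s : ℝ≥0 := ⟨32768 * Real.log (Fintype.card V) ^ 2 / ε ^ 4, hs0.le⟩
  have hs : 0 < s := hs0
  refine (lintegral_consensusTime_le f ε hs hb fun k => ?_).trans_eq ?_
  · rcases Nat.eq_zero_or_pos k with rfl | hk
    · simp [b]
    · refine (hf.measureReal_osc_gt_le hG hind hid hbd hε (t := k * s) (by positivity)).trans ?_
      refine (tail_bound_le hn hε hε2 hk ?_).trans_eq ?_
      · push_cast; rfl
      · simp [b, hk.ne']
  · congr 1
    change 32768 * Real.log (Fintype.card V) ^ 2 / ε ^ 4 * _ = _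
    ring
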